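/- Let $K$ be a field, $n,m\ge 0$ integers and $\mathbf d=(d_1,\dots,d_m)\in\mathbb Z^m$. For a commutative $K$-algebra $A$ let $A[\mathbf x]=A[x_0,\dots,x_n]$ and $A[\mathbf x]^m_{\mathbf d}=\bigoplus_{k=1}^m A[\mathbf x](-d_k)e_k$; a term is an element $x^\alpha e_k$, of degree $|\alpha|+d_k$. The variable $x_i$ is multiplicative for $x^\alpha e_k$ if $i\le j$ for every $x_j$ dividing $x^\alpha$, and the Pommaret cone of $x^\alpha e_k$ is the set of terms $x^\delta x^\alpha e_k$ with $x^\delta$ a product of multiplicative variables of $x^\alpha e_k$. Let $U\subseteq K[\mathbf x]^m_{\mathbf d}$ be a quasi-stable monomial module with Pommaret basis $\mathcal P(U)$, i.e. $\mathcal P(U)$ is a finite set of terms that generates $U$, and the set of terms in $U$ is the disjoint union of the Pommaret cones of the elements of $\mathcal P(U)$. Let $\mathcal N(U)$ be the set of terms not in $U$. A $\mathcal P(U)$-marked set in $A[\mathbf x]^m_{\mathbf d}$ is a family $G=(f_\alpha^k)_{x^\alpha e_k\in\mathcal P(U)}$ with $f_\alpha^k$ homogeneous of degree $\deg(x^\alpha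 e_k)$ and $f_\alpha^k-x^\alpha e_k$ an $A$-linear combination of terms in $\mathcal N(U)$. It is a $\mathcal P(U)$-marked basis if $(A[\mathbf x]^m_{\mathbf d})_s=\langle G\rangle_s\oplus\langle\mathcal N(U)_s\rangle^A$ for all $s\in\mathbb Z$, where $\langle G\rangle$ is the $A[\mathbf x]$-submodule generated by $G$ and $\langle\mathcal N(U)_s\rangle^A$ is the $A$-module generated by the terms of degree $s$ in $\mathcal N(U)$. A reduction step with respect to $G$ replaces $h$ by $h-\lambda x^\delta f_\alpha^k$, where $x^\alpha e_k\in\mathcal P(U)$, $x^\delta$ is a product of multiplicative variables of $x^\alpha e_k$, and $\lambda\ne 0$ is the coefficient of $x^\delta x^\alpha e_k$ in $h$; a complete reduction of $h$ is an $A$-linear combination of terms in $\mathcal N(U)$ that is reached from $h$ by finitely many reduction steps. Let $C$ be the set of variables $C_{\alpha\eta kl}$, one for each $x^\alpha e_k\in\mathcal P(U)$ and $x^\eta e_l\in\mathcal N(U)$ of the same degree, and let $\mathcal G\subset K[C][\mathbf x]^m_{\mathbf d}$ be the generic marked set, consisting of $$F_\alpha^k=x^\alpha e_k-\sum_{x^\eta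 e_l\in\mathcal N(U),\ \deg(x^\eta e_l)=\deg(x^\alpha e_k)}C_{\alpha\eta kl}\,x^\eta e_l\qquad(x^\alpha e_k\in\mathcal P(U)).$$ Let $\mathcal R\subseteq K[C]$ be the set of all coefficients of the terms of $\mathcal N(U)$ in the complete reductions, with respect to $\mathcal G$, of the elements $x_iF_\alpha^k$ with $x^\alpha e_k\in\mathcal P(U)$ and $x_i$ not multiplicative for $x^\alpha e_k$. Then the functor from Noetherian $K$-algebras to sets that sends $A$ to the set of $\mathcal P(U)$-marked bases in $A[\mathbf x]^m_{\mathbf d}$, and a homomorphism $\sigma:A\to B$ to $G\mapsto\sigma(G)$ ($\sigma$ applied to all coefficients), is represented by the affine $K$-scheme $\operatorname{Spec}(K[C]/\langle\mathcal R\rangle)$: it is naturally isomorphic to $A\mapsto\operatorname{Hom}_{\operatorname{Spec}K}(\operatorname{Spec}A,\operatorname{Spec}(K[C]/\langle\mathcal R\rangle))$. The isomorphism can be chosen so that, for every $K$-algebra homomorphism $\psi:K[C]/\langle\mathcal R\rangle\to A$, the morphism $\operatorname{Spec}\psi$ corresponds to the marked basis obtained from $\mathcal G$ by replacing each variable $C_{\alpha\eta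 kl}$ by the image of its class under $\psi$. -/

import Mathlib

open CategoryTheory AlgebraicGeometry Opposite

universe u

noncomputable section

namespace MarkedBases

/-- A term `x^α e_k` of the free module of rank `m` over the polynomial ring in
`x_0 < x_1 < ⋯ < x_n`, recorded as the pair `(k, α)`. -/
abbrev Term (m n : ℕ) : Type := Fin m × (Fin (n + 1) →₀ ℕ)

/-- The free module `A[x_0, …, x_n]^m`. -/
abbrev FreeMod (m n : ℕ) (A : Type u) [CommRing A] : Type u :=
  Fin m → MvPolynomial (Fin (n + 1)) A

section Basic

variable {m n : ℕ}

/-- The term `x^α e_k` as an element of `A[x]^m`. -/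
def termVec (A : Type u) [CommRing A] (τ : Term m n) : FreeMod m n A :=
  Pi.single τ.1 (MvPolynomial.monomial τ.2 1)

/-- The coefficient of the term `τ` in `f`. -/
def coeffAt {A : Type u} [CommRing A] (τ : Term m n) (f : FreeMod m n A) : A :=
  (f τ.1).coeff τ.2

/-- The product `x^δ · τ`. -/
def shift (δ : Fin (n + 1) →₀ ℕ) (τ : Term m n) : Term m n := (τ.1, δ + τ.2)

/-- The degree of a term of `⊕ A[x](-d_k) e_k`: the generator `e_k` has degree `d_k`. -/
def termDeg (d : Fin m → ℤ) (τ : Term m n) : ℤ := (τ.2.degree : ℤ) + d τ.1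

/-- The homogeneous component of degree `s` of `A[x]^m_d`, as an `A`-module. -/
def gradedPiece {A : Type u} [CommRing A] (d : Fin m → ℤ) (s : ℤ) :
    Submodule A (FreeMod m n A) where
  carrier := {f | ∀ τ, coeffAt τ f ≠ 0 → termDeg d τ = s}
  zero_mem' τ h := absurd (by simp [coeffAt]) h
  add_mem' {f g} hf hg τ h := by
    by_cases hfτ : coeffAt τ f = 0
    · refine hg τ fun hgτ => h ?_
      simpa [coeffAt, hfτ] using (by simpa [coeffAt] using congrArg₂ (· + ·) hfτ hgτ)
    · exact hf τ hfτ
  smul_mem' c f hf τ h := hf τ fun h0 => h (by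
    have : (f τ.1).coeff τ.2 = 0 := h0
    simp [coeffAt, this])

/-- `x_i` is a multiplicative variable of `x^α e_k`, that is `x_i ≤ min(x^α)`
(every variable is multiplicative for `α = 0`). -/
def IsMult (i : Fin (n + 1)) (τ : Term m n) : Prop := ∀ j, τ.2 j ≠ 0 → i ≤ j

/-- `x^δ` is a power product of multiplicative variables of `τ`. -/
def IsMultTerm (δ : Fin (n + 1) →₀ ℕ) (τ : Term m n) : Prop := ∀ i ∈ δ.support, IsMult i τ

/-- The Pommaret cone of a term. -/
def pommaretCone (τ : Term m n) : Set (Term m n) := {σ | ∃ δ, IsMultTerm δ τ ∧ σ = shift δ τ}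

/-- The finite set of terms `P` is a Pommaret basis of the submodule `U` of `K[x]^m`: it generates
`U`, and the set of terms in `U` is the disjoint union of the Pommaret cones of the elements
of `P`. A submodule `U` with a Pommaret basis is by definition a quasi-stable (monomial) module. -/
structure IsPommaretBasis {K : Type u} [Field K]
    (U : Submodule (MvPolynomial (Fin (n + 1)) K) (FreeMod m n K)) (P : Finset (Term m n)) :
    Prop where
  span_eq : Submodule.span (MvPolynomial (Fin (n + 1)) K) (termVec K '' (P : Set (Term m n))) = U
  terms_eq : {τ : Term m n | termVec K τ ∈ U} = ⋃ τ ∈ P, pommaretCone τ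
  disjoint : (P : Set (Term m n)).PairwiseDisjoint pommaretCone

/-- `𝒩(U)`: the terms not in the monomial module `U`. -/
def normalTerms {K : Type u} [Field K]
    (U : Submodule (MvPolynomial (Fin (n + 1)) K) (FreeMod m n K)) : Set (Term m n) :=
  {τ | termVec K τ ∉ U}

end Basic

section Marked

variable {m n : ℕ} {K : Type u} [Field K] (d : Fin m → ℤ)
  (U : Submodule (MvPolynomial (Fin (n + 1)) K) (FreeMod m n K)) (P : Finset (Term m n))

/-- `g` lies in the `A`-module `⟨𝒩(U)⟩`: all terms in the support of `g` lie in `𝒩(U)`. -/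
def SupportedOnNormal {A : Type u} [CommRing A] (g : FreeMod m n A) : Prop :=
  ∀ η, coeffAt η g ≠ 0 → η ∈ normalTerms U

/-- A `P`-marked set in `A[x]^m_d`, given by its elements `f τ` indexed by their head terms `τ ∈ P`:
`f τ` is homogeneous (of the degree of `τ`), and `f τ - τ` is supported on `𝒩(U)`; thus `τ` has
coefficient `1` in `f τ`. -/
def IsMarkedSet {A : Type u} [CommRing A] (f : P → FreeMod m n A) : Prop :=
  ∀ τ : P, f τ ∈ gradedPiece (A := A) d (termDeg d τ.1) ∧
    SupportedOnNormal U (f τ - termVec A τ.1)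

/-- The component `⟨G⟩_s` of degree `s` of the `A[x]`-submodule generated by `G = {f τ}`. -/
def genPiece {A : Type u} [CommRing A] (f : P → FreeMod m n A) (s : ℤ) :
    Submodule A (FreeMod m n A) :=
  (Submodule.span (MvPolynomial (Fin (n + 1)) A) (Set.range f)).restrictScalars A ⊓
    gradedPiece d s

/-- The `A`-module `⟨𝒩(U)_s⟩^A` generated by the terms of degree `s` in `𝒩(U)`. -/
def normalPiece (A : Type u) [CommRing A] (s : ℤ) : Submodule A (FreeMod m n A) :=
  Submodule.span A (termVec A '' {η | η ∈ normalTerms U ∧ termDeg d η = s})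

/-- A `P`-marked basis: a `P`-marked set `G` with
`(A[x]^m_d)_s = ⟨G⟩_s ⊕ ⟨𝒩(U)_s⟩^A` for all `s`. -/
structure IsMarkedBasis {A : Type u} [CommRing A] (f : P → FreeMod m n A) : Prop where
  marked : IsMarkedSet d U P f
  sup_eq : ∀ s : ℤ, genPiece d P f s ⊔ normalPiece d U A s = gradedPiece d s
  disjoint : ∀ s : ℤ, Disjoint (genPiece d P f s) (normalPiece d U A s)

/-- One step of the reduction relation of a `P`-marked set `G = {f τ}`: a term
`x^δ τ` that occurs in `h` with coefficient `c ≠ 0`, where `x^δ` is multiplicative for `τ ∈ P`, is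
removed by subtracting `c x^δ f τ`. -/
def ReductionStep {A : Type u} [CommRing A] (f : P → FreeMod m n A) (h h' : FreeMod m n A) :
    Prop :=
  ∃ (τ : P) (δ : Fin (n + 1) →₀ ℕ), IsMultTerm δ τ.1 ∧ coeffAt (shift δ τ.1) h ≠ 0 ∧
    h' = h - MvPolynomial.monomial δ (coeffAt (shift δ τ.1) h) • f τ

/-- `g` is a complete reduction of `h`: finitely many reduction steps lead from `h` to `g`, and
`g ∈ ⟨𝒩(U)⟩`. -/
def IsCompleteReduction {A : Type u} [CommRing A] (f : P → FreeMod m n A)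
    (h g : FreeMod m n A) : Prop :=
  Relation.ReflTransGen (ReductionStep P f) h g ∧ SupportedOnNormal U g

/-- The terms `x^η e_l ∈ 𝒩(U)` of degree `deg(τ)`. -/
abbrev Tail (τ : P) : Type := {η : Term m n // η ∈ normalTerms U ∧ termDeg d η = termDeg d τ.1}

instance finite_tail (τ : P) : Finite (Tail d U P τ) := by
  have h : Set.Finite {η : Term m n | termDeg d η = termDeg d τ.1} := by
    have hfin : Set.Finite (⋃ k : Fin m, (Prod.mk k) ''
        {α : Fin (n + 1) →₀ ℕ | α.degree ≤ (termDeg d τ.1 - d k).toNat}) :=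
      Set.finite_iUnion fun k => (Finsupp.finite_of_degree_le _).image _
    refine hfin.subset ?_
    rintro ⟨k, α⟩ hα
    refine Set.mem_iUnion.2 ⟨k, α, ?_, rfl⟩
    simp only [Set.mem_ofPred_eq, termDeg] at hα ⊢
    omega
  exact (h.subset fun η hη => hη.2).to_subtype

instance fintype_tail (τ : P) : Fintype (Tail d U P τ) := Fintype.ofFinite _

/-- The index set of the variables `C`: one variable for every pair of a term `τ ∈ P` and a term
`η ∈ 𝒩(U)` of the same degree. -/
abbrev Param : Type := Σ τ : P, Tail d U P τ

/-- The polynomial ring `K[C]`. -/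
abbrev ParamRing : Type u := MvPolynomial (Param d U P) K

/-- The generic marked set: `F_τ = τ - ∑_η C_{τη} η`. -/
def genericSet (τ : P) : FreeMod m n (ParamRing d U P) :=
  termVec (ParamRing d U P) τ.1 -
    ∑ η : Tail d U P τ,
      (MvPolynomial.X ⟨τ, η⟩ : ParamRing d U P) • termVec (ParamRing d U P) η.1

/-- The set `ℛ ⊆ K[C]` of all coefficients of the terms `η ∈ 𝒩(U)` in the complete reductions of
`x_i F_τ` by the generic marked set, for `τ ∈ P` and `x_i` non-multiplicative for `τ`. -/
def relations : Set (ParamRing d U P) :=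
  {c | ∃ (τ : P) (i : Fin (n + 1)), ¬ IsMult i τ.1 ∧
    ∃ L, IsCompleteReduction U P (genericSet d U P)
      ((MvPolynomial.X i : MvPolynomial (Fin (n + 1)) (ParamRing d U P)) • genericSet d U P τ) L ∧
    ∃ η ∈ normalTerms U, c = coeffAt η L}

/-- The `K`-algebra `K[C]/⟨ℛ⟩`. -/
abbrev CoordRing : Type u := ParamRing d U P ⧸ Ideal.span (relations d U P)

end Marked

section BaseChange

variable {m n : ℕ} {A B : Type u} [CommRing A] [CommRing B]

/-- Apply a ring homomorphism to all coefficients of an element of `A[x]^m`, as a semilinear map. -/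
def mapCoeff (σ : A →+* B) : FreeMod m n A →ₛₗ[σ] FreeMod m n B where
  toFun f := fun k => MvPolynomial.map σ (f k)
  map_add' f g := by ext1 k; simp
  map_smul' a f := by ext1 k; simp [MvPolynomial.smul_eq_C_mul]

theorem mapCoeff_apply (σ : A →+* B) (f : FreeMod m n A) (k : Fin m) :
    mapCoeff σ f k = MvPolynomial.map σ (f k) := rfl

theorem coeffAt_mapCoeff (σ : A →+* B) (f : FreeMod m n A) (τ : Term m n) :
    coeffAt τ (mapCoeff σ f) = σ (coeffAt τ f) := by
  simp [coeffAt, mapCoeff_apply, MvPolynomial.coeff_map]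

theorem mapCoeff_poly_smul (σ : A →+* B) (p : MvPolynomial (Fin (n + 1)) A) (f : FreeMod m n A) :
    mapCoeff σ (p • f) = MvPolynomial.map σ p • mapCoeff σ f := by
  ext1 k; simp [mapCoeff_apply]

theorem mapCoeff_termVec (σ : A →+* B) (τ : Term m n) :
    mapCoeff σ (termVec A τ) = termVec B τ := by
  ext1 k
  rw [mapCoeff_apply, termVec, termVec]
  rcases eq_or_ne k τ.1 with rfl | h
  · simp [MvPolynomial.map_monomial]
  · simp [Pi.single_eq_of_ne h]

theorem coeffAt_termVec (σ τ : Term m n) :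
    coeffAt σ (termVec A τ) = if σ = τ then 1 else 0 := by
  obtain ⟨k, α⟩ := σ
  obtain ⟨l, β⟩ := τ
  rw [coeffAt, termVec]
  rcases eq_or_ne k l with rfl | h
  · simp [MvPolynomial.coeff_monomial, eq_comm]
  · simp [h]

variable (m n A) in
/-- The terms form a basis of `A[x]^m` over `A`. -/
def termBasis : Module.Basis (Σ _ : Fin m, Fin (n + 1) →₀ ℕ) A (FreeMod m n A) :=
  Pi.basis fun _ => MvPolynomial.basisMonomials (Fin (n + 1)) A

theorem termBasis_apply (i : Σ _ : Fin m, Fin (n + 1) →₀ ℕ) :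
    termBasis m n A i = termVec A (i.1, i.2) := by
  simp [termBasis, termVec, Pi.basis_apply]

theorem termBasis_repr (f : FreeMod m n A) (i : Σ _ : Fin m, Fin (n + 1) →₀ ℕ) :
    (termBasis m n A).repr f i = coeffAt (i.1, i.2) f := by
  simp only [termBasis, Pi.basis_repr, coeffAt]
  rfl

theorem gradedPiece_eq_span (d : Fin m → ℤ) (s : ℤ) :
    gradedPiece (A := A) (n := n) d s =
      Submodule.span A (termVec A '' {τ : Term m n | termDeg d τ = s}) := by
  apply le_antisymm
  · intro f hf
    rw [← (termBasis m n A).linearCombination_repr f, Finsupp.linearCombination_apply]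
    refine Submodule.sum_mem _ fun i hi => Submodule.smul_mem _ _ (Submodule.subset_span ?_)
    rw [Finsupp.mem_support_iff, termBasis_repr] at hi
    exact ⟨_, hf _ hi, (termBasis_apply i).symm⟩
  · rw [Submodule.span_le]
    rintro _ ⟨τ, hτ, rfl⟩ σ hσ
    rw [coeffAt_termVec] at hσ
    by_cases h : σ = τ
    · rw [h]; exact hτ
    · simp [h] at hσ

variable {K : Type u} [Field K] {d : Fin m → ℤ}
  {U : Submodule (MvPolynomial (Fin (n + 1)) K) (FreeMod m n K)} {P : Finset (Term m n)}

theorem normalPiece_le_gradedPiece (s : ℤ) : normalPiece d U A s ≤ gradedPiece d s := by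
  rw [gradedPiece_eq_span]
  exact Submodule.span_mono (Set.image_mono fun _ h => h.2)

theorem mapCoeff_mem_gradedPiece (σ : A →+* B) {s : ℤ} {f : FreeMod m n A}
    (hf : f ∈ gradedPiece (A := A) d s) : mapCoeff σ f ∈ gradedPiece (A := B) d s := by
  intro τ hτ
  refine hf τ fun h => hτ ?_
  rw [coeffAt_mapCoeff, h, map_zero]

theorem mapCoeff_mem_normalPiece (σ : A →+* B) {s : ℤ} {f : FreeMod m n A}
    (hf : f ∈ normalPiece d U A s) : mapCoeff σ f ∈ normalPiece d U B s := by
  refine Submodule.span_induction (p := fun x _ => mapCoeff σ x ∈ normalPiece d U B s)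
    ?_ ?_ ?_ ?_ hf
  · rintro _ ⟨τ, hτ, rfl⟩
    rw [mapCoeff_termVec]
    exact Submodule.subset_span ⟨τ, hτ, rfl⟩
  · rw [map_zero]; exact zero_mem _
  · intro x y _ _ hx hy; rw [map_add]; exact add_mem hx hy
  · intro a x _ hx; rw [map_smulₛₗ]; exact Submodule.smul_mem _ _ hx

theorem mapCoeff_mem_genPiece (σ : A →+* B) {f : P → FreeMod m n A} {s : ℤ} {h : FreeMod m n A}
    (hh : h ∈ genPiece d P f s) : mapCoeff σ h ∈ genPiece d P (fun τ => mapCoeff σ (f τ)) s := by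
  refine ⟨?_, mapCoeff_mem_gradedPiece σ hh.2⟩
  have hh1 : h ∈ Submodule.span (MvPolynomial (Fin (n + 1)) A) (Set.range f) := hh.1
  change mapCoeff σ h ∈ Submodule.span (MvPolynomial (Fin (n + 1)) B) _
  refine Submodule.span_induction (p := fun x _ => mapCoeff σ x ∈
    Submodule.span (MvPolynomial (Fin (n + 1)) B) (Set.range fun τ => mapCoeff σ (f τ)))
    ?_ ?_ ?_ ?_ hh1
  · rintro _ ⟨τ, rfl⟩
    exact Submodule.subset_span ⟨τ, rfl⟩
  · rw [map_zero]; exact zero_mem _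
  · intro x y _ _ hx hy; rw [map_add]; exact add_mem hx hy
  · intro a x _ hx; rw [mapCoeff_poly_smul]; exact Submodule.smul_mem _ _ hx

theorem IsMarkedSet.map (σ : A →+* B) {f : P → FreeMod m n A} (hf : IsMarkedSet d U P f) :
    IsMarkedSet d U P fun τ => mapCoeff σ (f τ) := by
  refine fun τ => ⟨mapCoeff_mem_gradedPiece σ (hf τ).1, fun η hη => (hf τ).2 η fun h => hη ?_⟩
  rw [← mapCoeff_termVec σ, ← map_sub, coeffAt_mapCoeff, h, map_zero]

theorem coeffAt_monomial_smul (δ : Fin (n + 1) →₀ ℕ) (f : FreeMod m n A) (τ : Term m n)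
    (h : coeffAt τ (MvPolynomial.monomial δ (1 : A) • f) ≠ 0) :
    ∃ σ, τ = shift δ σ ∧ coeffAt σ f ≠ 0 := by
  rw [coeffAt, Pi.smul_apply, smul_eq_mul, MvPolynomial.coeff_monomial_mul'] at h
  split_ifs at h with hle
  · refine ⟨(τ.1, τ.2 - δ), Prod.ext rfl ?_, by simpa [coeffAt] using h⟩
    simp only [shift]
    exact (add_tsub_cancel_of_le hle).symm
  · exact absurd rfl h

theorem termDeg_shift (δ : Fin (n + 1) →₀ ℕ) (τ : Term m n) :
    termDeg d (shift δ τ) = δ.degree + termDeg d τ := by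
  simp [termDeg, shift, add_assoc]

/-- Marked bases are preserved by extension of scalars. -/
theorem IsMarkedBasis.map (σ : A →+* B) {f : P → FreeMod m n A} (hf : IsMarkedBasis d U P f) :
    IsMarkedBasis d U P fun τ => mapCoeff σ (f τ) := by
  have key : ∀ τ : Term m n, ∃ w ∈ genPiece d P f (termDeg d τ),
      ∃ v ∈ normalPiece d U A (termDeg d τ), w + v = termVec A τ := fun τ => by
    rw [← Submodule.mem_sup, hf.sup_eq, gradedPiece_eq_span]
    exact Submodule.subset_span ⟨τ, rfl, rfl⟩
  choose w hw v hv hwv using key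
  refine ⟨hf.marked.map σ, fun s => le_antisymm
    (sup_le inf_le_right (normalPiece_le_gradedPiece s)) ?_, fun s => ?_⟩
  · rw [gradedPiece_eq_span, Submodule.span_le]
    rintro _ ⟨τ, rfl, rfl⟩
    rw [← mapCoeff_termVec σ, ← hwv τ, map_add]
    exact Submodule.add_mem_sup (mapCoeff_mem_genPiece σ (hw τ)) (mapCoeff_mem_normalPiece σ (hv τ))
  -- the projection onto the span of `𝒩(U)` along `⟨G⟩`, and its base change
  let πA : FreeMod m n A →ₗ[A] FreeMod m n A :=
    (termBasis m n A).constr A fun i => v (i.1, i.2)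
  let πB : FreeMod m n B →ₗ[B] FreeMod m n B :=
    (termBasis m n B).constr B fun i => mapCoeff σ (v (i.1, i.2))
  have hπA : ∀ τ, πA (termVec A τ) = v τ := fun τ => by
    have := (termBasis m n A).constr_basis A (fun i => v (i.1, i.2)) ⟨τ.1, τ.2⟩
    rwa [termBasis_apply] at this
  have hπB : ∀ τ, πB (termVec B τ) = mapCoeff σ (v τ) := fun τ => by
    have := (termBasis m n B).constr_basis B (fun i => mapCoeff σ (v (i.1, i.2))) ⟨τ.1, τ.2⟩
    rwa [termBasis_apply] at this
  have hcomm : ∀ h, πB (mapCoeff σ h) = mapCoeff σ (πA h) := by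
    have : πB.comp (mapCoeff σ) = (mapCoeff σ).comp πA := by
      refine (termBasis m n A).ext fun i => ?_
      simp only [LinearMap.comp_apply, termBasis_apply, mapCoeff_termVec, hπA, hπB]
    exact fun h => LinearMap.congr_fun this h
  have hvN : ∀ η ∈ normalTerms U, v η = termVec A η := fun η hη => by
    have h1 : termVec A η ∈ normalPiece d U A (termDeg d η) :=
      Submodule.subset_span ⟨η, ⟨hη, rfl⟩, rfl⟩
    have h2 : w η = termVec A η - v η := by rw [← hwv η, add_sub_cancel_right]
    have h3 : w η = 0 := Submodule.disjoint_def.1 (hf.disjoint (termDeg d η)) _ (hw η)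
      (h2 ▸ sub_mem h1 (hv η))
    rw [← hwv η, h3, zero_add]
  have hdiff : ∀ h, h - πA h ∈ Submodule.span (MvPolynomial (Fin (n + 1)) A) (Set.range f) := by
    intro h
    have hmem : h ∈ Submodule.span A (Set.range (termBasis m n A)) := by
      rw [(termBasis m n A).span_eq]; trivial
    refine Submodule.span_induction (p := fun x _ => x - πA x ∈
      Submodule.span (MvPolynomial (Fin (n + 1)) A) (Set.range f)) ?_ ?_ ?_ ?_ hmem
    · rintro _ ⟨i, rfl⟩
      rw [termBasis_apply, hπA, ← hwv, add_sub_cancel_right]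
      exact (hw _).1
    · rw [map_zero, sub_zero]; exact zero_mem _
    · intro x y _ _ hx hy
      rw [map_add, add_sub_add_comm]
      exact add_mem hx hy
    · intro a x _ hx
      rw [map_smul, ← smul_sub, ← algebraMap_smul (MvPolynomial (Fin (n + 1)) A) a]
      exact Submodule.smul_mem _ _ hx
  have hgr : ∀ s, ∀ h ∈ gradedPiece (A := A) d s, πA h ∈ normalPiece d U A s := by
    intro s h hh
    rw [gradedPiece_eq_span] at hh
    refine Submodule.span_induction (p := fun x _ => πA x ∈ normalPiece d U A s) ?_ ?_ ?_ ?_ hh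
    · rintro _ ⟨τ, rfl, rfl⟩
      rw [hπA]; exact hv τ
    · rw [map_zero]; exact zero_mem _
    · intro x y _ _ hx hy; rw [map_add]; exact add_mem hx hy
    · intro a x _ hx; rw [map_smul]; exact Submodule.smul_mem _ _ hx
  have hkill : ∀ s, ∀ h ∈ genPiece d P f s, πA h = 0 := by
    intro s h hh
    refine Submodule.disjoint_def.1 (hf.disjoint s) _ ⟨?_, ?_⟩ (hgr s h hh.2)
    · have := sub_mem (show h ∈ Submodule.span (MvPolynomial (Fin (n + 1)) A) _ from hh.1) (hdiff h)
      rwa [sub_sub_cancel] at this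
    · exact normalPiece_le_gradedPiece s (hgr s h hh.2)
  have hmon : ∀ (τ : P) (δ : Fin (n + 1) →₀ ℕ),
      πB (MvPolynomial.monomial δ (1 : B) • mapCoeff σ (f τ)) = 0 := by
    intro τ δ
    have h1 : MvPolynomial.monomial δ (1 : A) • f τ ∈
        genPiece d P f (δ.degree + termDeg d τ.1) := by
      have h0 : MvPolynomial.monomial δ (1 : A) • f τ ∈
          Submodule.span (MvPolynomial (Fin (n + 1)) A) (Set.range f) :=
        Submodule.smul_mem _ _ (Submodule.subset_span (Set.mem_range_self τ))
      refine ⟨h0, fun ρ hρ => ?_⟩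
      obtain ⟨ρ', rfl, h'⟩ := coeffAt_monomial_smul δ (f τ) ρ hρ
      rw [termDeg_shift, (hf.marked τ).1 ρ' h']
    have h2 : MvPolynomial.monomial δ (1 : B) • mapCoeff σ (f τ) =
        mapCoeff σ (MvPolynomial.monomial δ (1 : A) • f τ) := by
      rw [mapCoeff_poly_smul, MvPolynomial.map_monomial, map_one σ]
    rw [h2, hcomm, hkill _ _ h1, map_zero]
  have hpoly : ∀ (τ : P) (p : MvPolynomial (Fin (n + 1)) B),
      πB (p • mapCoeff σ (f τ)) = 0 := by
    intro τ p
    induction p using MvPolynomial.induction_on' with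
    | monomial δ c =>
      have hc : MvPolynomial.monomial δ c = c • MvPolynomial.monomial δ (1 : B) := by
        rw [MvPolynomial.smul_monomial, smul_eq_mul, mul_one]
      rw [hc, smul_assoc, map_smul, hmon, smul_zero]
    | add p q hp hq => rw [add_smul, map_add, hp, hq, add_zero]
  have hkillB : ∀ h ∈ Submodule.span (MvPolynomial (Fin (n + 1)) B)
      (Set.range fun τ => mapCoeff σ (f τ)), πB h = 0 := by
    intro h hh
    induction hh using Submodule.closure_induction with
    | zero => simp
    | add x y _ _ hx hy => rw [map_add, hx, hy, add_zero]
    | smul_mem p x hx =>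
      obtain ⟨τ, rfl⟩ := hx
      exact hpoly τ p
  have hid : ∀ g ∈ normalPiece d U B s, πB g = g := by
    intro g hg
    refine Submodule.span_induction (p := fun x _ => πB x = x) ?_ ?_ ?_ ?_ hg
    · rintro _ ⟨η, hη, rfl⟩
      rw [hπB, hvN η hη.1, mapCoeff_termVec]
    · rw [map_zero]
    · intro x y _ _ hx hy; rw [map_add, hx, hy]
    · intro a x _ hx; rw [map_smul, hx]
  rw [Submodule.disjoint_def]
  intro g hg1 hg2
  rw [← hid g hg2]
  exact hkillB g hg1.1

end BaseChange

section Functors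

variable {m n : ℕ} {K : Type u} [Field K] (d : Fin m → ℤ)
  (U : Submodule (MvPolynomial (Fin (n + 1)) K) (FreeMod m n K)) (P : Finset (Term m n))

variable (K) in
/-- The category of Noetherian commutative `K`-algebras. -/
abbrev NoethAlgCat : Type (u + 1) :=
  ObjectProperty.FullSubcategory fun A : CommAlgCat.{u} (CommRingCat.of K) => IsNoetherianRing A

/-- The functor of marked bases over `P`: a Noetherian `K`-algebra `A` is sent to the set of
`P`-marked bases in `A[x]^m_d`, and `σ : A ⟶ B` acts by applying `σ` to all coefficients. -/
def markedBasisFunctor : NoethAlgCat K ⥤ Type u where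
  obj A := {f : P → FreeMod m n A.obj // IsMarkedBasis d U P f}
  map σ := TypeCat.ofHom fun f =>
    ⟨fun τ => mapCoeff σ.hom.hom.toRingHom (f.1 τ), f.2.map σ.hom.hom.toRingHom⟩
  map_id A := by
    refine ConcreteCategory.hom_ext _ _ fun f => ?_
    refine Subtype.ext (funext fun τ => funext fun k => ?_)
    exact MvPolynomial.map_id _
  map_comp σ ρ := by
    refine ConcreteCategory.hom_ext _ _ fun f => ?_
    refine Subtype.ext (funext fun τ => funext fun k => ?_)
    exact (MvPolynomial.map_map σ.hom.hom.toRingHom ρ.hom.hom.toRingHom _).symm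

variable (K) in
/-- The functor `A ↦ Spec A` from Noetherian `K`-algebras to schemes over `Spec K`. -/
def noethSpec : (NoethAlgCat K)ᵒᵖ ⥤ Over (Spec (CommRingCat.of K)) :=
  (ObjectProperty.ι _).op ⋙ algSpec (CommRingCat.of K)

/-- The functor of points `A ↦ Hom_{Spec K}(Spec A, X)` of a scheme `X` over `Spec K`, on Noetherian
`K`-algebras. -/
def pointsFunctor (X : Over (Spec (CommRingCat.of K))) : NoethAlgCat K ⥤ Type u :=
  (noethSpec K).rightOp ⋙ yoneda.obj X

/-- The affine `K`-scheme `Spec (K[C]/⟨ℛ⟩)`. -/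
def markedScheme : Over (Spec (CommRingCat.of K)) :=
  (algSpec (CommRingCat.of K)).obj (op (CommAlgCat.of (CommRingCat.of K) (CoordRing d U P)))

/-- The morphism `Spec A ⟶ Spec (K[C]/⟨ℛ⟩)` over `Spec K` given by a `K`-algebra homomorphism. -/
def markedPoint (A : NoethAlgCat K) (ψ : CoordRing d U P →ₐ[K] A.obj) :
    (pointsFunctor (markedScheme d U P)).obj A :=
  (algSpec (CommRingCat.of K)).map
    (CommAlgCat.ofHom (R := CommRingCat.of K) (Y := A.obj) ψ).op

end Functors

end MarkedBases

end

open MarkedBases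

noncomputable section

namespace MarkedBases

/-! ### Coefficients, multipliers and the colexicographic order -/

section Terms

variable {m n : ℕ}

/-! A marked set over `A` is the same thing as a choice of its tail coefficients, hence as a
`K`-algebra map `φ : K[C] → A`. What must be shown is that the specialised set is a marked basis
exactly when `φ` kills `ℛ`; `algHomEquivMarkedBasis` then follows, and full faithfulness of `Spec`
turns algebra maps into points.

The engine is the colexicographic order on multipliers `x^δ`, a well-order compatible with
multiplication. By `toColex_lt_or_le` and disjointness of the cones, if a non-head term of `x^δ f_τ`
lies in a cone, its multiplier there is smaller than `δ`. This gives termination of reduction, and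
independence of normal terms from the multiplicative products (`eq_zero_of_mem_fullMultSpan`). If
moreover each non-multiplicative `x_i f_τ` is a combination of products with multiplier smaller than
`x_i`, the multiplicative products span all of `⟨G⟩` (`span_le_fullMultSpan`), so the set is a
marked basis.

If `φ` kills `ℛ`, the reduction of `x_i F_τ` over `K[C]` specialises to such a combination.
Conversely, for a marked basis every complete reduction of `x_i F_τ` specialises into `⟨G⟩ ∩ ⟨𝒩(U)⟩
= 0`. Uniqueness of complete reductions over `K[C]` is never needed. -/

theorem coeffAt_add {A : Type u} [CommRing A] (τ : Term m n) (f g : FreeMod m n A) :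
    coeffAt τ (f + g) = coeffAt τ f + coeffAt τ g := by simp [coeffAt]

theorem coeffAt_sub {A : Type u} [CommRing A] (τ : Term m n) (f g : FreeMod m n A) :
    coeffAt τ (f - g) = coeffAt τ f - coeffAt τ g := by simp [coeffAt]

theorem coeffAt_smul {A : Type u} [CommRing A] (τ : Term m n) (a : A) (f : FreeMod m n A) :
    coeffAt τ (a • f) = a * coeffAt τ f := by simp [coeffAt]

theorem coeffAt_zero {A : Type u} [CommRing A] (τ : Term m n) :
    coeffAt τ (0 : FreeMod m n A) = 0 := by simp [coeffAt]

theorem coeffAt_sum {A : Type u} [CommRing A] {ι : Type*} (τ : Term m n) (s : Finset ι)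
    (f : ι → FreeMod m n A) : coeffAt τ (∑ i ∈ s, f i) = ∑ i ∈ s, coeffAt τ (f i) := by
  simp [coeffAt, Finset.sum_apply, MvPolynomial.coeff_sum]

theorem ext_coeffAt {A : Type u} [CommRing A] {f g : FreeMod m n A}
    (h : ∀ τ, coeffAt τ f = coeffAt τ g) : f = g := by
  ext k α
  exact h (k, α)

theorem coeffAt_shift_monomial_smul {A : Type u} [CommRing A] (δ : Fin (n + 1) →₀ ℕ)
    (f : FreeMod m n A) (τ : Term m n) :
    coeffAt (shift δ τ) (MvPolynomial.monomial δ (1 : A) • f) = coeffAt τ f := by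
  simp [coeffAt, shift]

theorem monomial_smul_eq {A : Type u} [CommRing A] (δ : Fin (n + 1) →₀ ℕ) (c : A)
    (f : FreeMod m n A) :
    MvPolynomial.monomial δ c • f = c • (MvPolynomial.monomial δ (1 : A) • f) := by
  rw [← smul_assoc, MvPolynomial.smul_monomial, smul_eq_mul, mul_one]

theorem shift_shift (δ ε : Fin (n + 1) →₀ ℕ) (τ : Term m n) :
    shift δ (shift ε τ) = shift (δ + ε) τ := by
  simp [shift, add_assoc]

theorem shift_injective (δ : Fin (n + 1) →₀ ℕ) :
    Function.Injective (shift δ : Term m n → Term m n) := by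
  rintro ⟨k, α⟩ ⟨l, β⟩ h
  simpa [shift] using h

theorem IsMultTerm.of_le {δ ε : Fin (n + 1) →₀ ℕ} {τ : Term m n} (h : IsMultTerm δ τ)
    (hle : ε ≤ δ) : IsMultTerm ε τ := fun i hi => h i (Finsupp.support_mono hle hi)

/-- If `x^δ x^α = x^δ' x^β` with `x^δ'` multiplicative for `x^β`, then `x^δ'` is smaller than `x^δ`
or divisible by it. -/
theorem toColex_lt_or_le {δ δ' : Fin (n + 1) →₀ ℕ} {σ τ : Term m n}
    (h : shift δ σ = shift δ' τ) (hmult : IsMultTerm δ' τ) :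
    toColex δ' < toColex δ ∨ δ ≤ δ' := by
  rcases lt_trichotomy (toColex δ') (toColex δ) with hlt | heq | hlt
  · exact Or.inl hlt
  · exact Or.inr (toColex_inj.1 heq).ge
  · right
    obtain ⟨i, hi, hlt⟩ := Finsupp.Colex.lt_iff.1 hlt
    change ∀ j, i < j → δ j = δ' j at hi
    change δ i < δ' i at hlt
    intro j
    rcases lt_trichotomy i j with hij | rfl | hij
    · exact (hi j hij).le
    · exact hlt.le
    -- At the largest index `i` where they differ, `δ'` is positive, so `x_i` is multiplicative and
    -- `τ` involves no `x_j` with `j < i`. Below `i` the equality of terms then forces `δ j ≤ δ' j`.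
    · have hτ : τ.2 j = 0 := by
        by_contra h0
        have := hmult i (Finsupp.mem_support_iff.2 (by omega)) j h0
        exact absurd hij this.not_gt
      have h2 := DFunLike.congr_fun (congrArg Prod.snd h) j
      simp only [shift, Finsupp.add_apply] at h2
      omega

theorem eq_shift_sub {δ δ' : Fin (n + 1) →₀ ℕ} {σ τ : Term m n}
    (h : shift δ σ = shift δ' τ) (hle : δ ≤ δ') : σ = shift (δ' - δ) τ := by
  apply shift_injective δ
  rw [h, shift_shift, add_tsub_cancel_of_le hle]

end Terms

/-! ### Pommaret cones and normal terms -/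

section Pommaret

variable {m n : ℕ} {K : Type u} [Field K]
  {U : Submodule (MvPolynomial (Fin (n + 1)) K) (FreeMod m n K)} {P : Finset (Term m n)}

theorem IsPommaretBasis.not_mem_normalTerms_iff (hP : IsPommaretBasis U P) {σ : Term m n} :
    σ ∉ normalTerms U ↔ ∃ (τ : P) (δ : Fin (n + 1) →₀ ℕ), IsMultTerm δ τ.1 ∧ σ = shift δ τ.1 := by
  have h := Set.ext_iff.1 hP.terms_eq σ
  simp only [Set.mem_iUnion, pommaretCone, Set.mem_ofPred_eq] at h
  simp only [normalTerms, Set.mem_ofPred_eq, not_not, h, Subtype.exists, exists_prop]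

theorem IsPommaretBasis.shift_not_mem_normalTerms (hP : IsPommaretBasis U P)
    {τ : Term m n} (hτ : τ ∈ P) {δ : Fin (n + 1) →₀ ℕ} (hδ : IsMultTerm δ τ) :
    shift δ τ ∉ normalTerms U :=
  hP.not_mem_normalTerms_iff.2 ⟨⟨τ, hτ⟩, δ, hδ, rfl⟩

theorem IsPommaretBasis.not_mem_normalTerms (hP : IsPommaretBasis U P)
    {τ : Term m n} (hτ : τ ∈ P) : τ ∉ normalTerms U := by
  have := hP.shift_not_mem_normalTerms hτ (δ := 0) (fun i hi => by simp at hi)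
  simpa [shift] using this

theorem IsPommaretBasis.eq_of_shift_eq (hP : IsPommaretBasis U P)
    {τ τ' : P} {δ δ' : Fin (n + 1) →₀ ℕ} (hδ : IsMultTerm δ τ.1)
    (hδ' : IsMultTerm δ' τ'.1) (h : shift δ τ.1 = shift δ' τ'.1) : τ = τ' ∧ δ = δ' := by
  have hτ : τ = τ' := by
    by_contra hne
    exact Set.disjoint_left.1 (hP.disjoint τ.2 τ'.2 fun h' => hne (Subtype.ext h'))
      ⟨δ, hδ, rfl⟩ ⟨δ', hδ', h⟩
  subst hτ
  exact ⟨rfl, by simpa [shift] using h⟩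

/-- Otherwise `x^δ` divides `x^δ'`, and cancelling it puts `η` into the cone of `τ`, hence into `U`.
-/
theorem IsPommaretBasis.toColex_lt_of_mem_normalTerms (hP : IsPommaretBasis U P)
    {η τ : Term m n} (hη : η ∈ normalTerms U) (hτ : τ ∈ P) {δ δ' : Fin (n + 1) →₀ ℕ}
    (hmult : IsMultTerm δ' τ) (h : shift δ η = shift δ' τ) : toColex δ' < toColex δ := by
  refine (toColex_lt_or_le h hmult).resolve_right fun hle => ?_
  rw [eq_shift_sub h hle] at hη
  exact hP.shift_not_mem_normalTerms hτ (hmult.of_le tsub_le_self) hη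

/-- Otherwise `x_i` divides `x^δ'`, and cancelling it puts `σ` into the cone of `τ`. Disjointness of
cones gives `σ = τ`, so `x_i` would be multiplicative for `σ`. -/
theorem IsPommaretBasis.toColex_lt_single (hP : IsPommaretBasis U P) {i : Fin (n + 1)}
    {σ τ : P} (hi : ¬ IsMult i σ.1) {δ' : Fin (n + 1) →₀ ℕ}
    (hmult : IsMultTerm δ' τ.1) (h : shift (Finsupp.single i 1) σ.1 = shift δ' τ.1) :
    toColex δ' < toColex (Finsupp.single i 1) := by
  refine (toColex_lt_or_le h hmult).resolve_right fun hle => hi ?_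
  have h1 := eq_shift_sub h hle
  have h0 : shift 0 σ.1 = σ.1 := by simp [shift]
  obtain ⟨rfl, -⟩ := hP.eq_of_shift_eq (δ := 0) (fun i hi => by simp at hi)
    (hmult.of_le tsub_le_self) (h0.trans h1)
  refine hmult i (Finsupp.mem_support_iff.2 ?_)
  have := hle i
  rw [Finsupp.single_eq_same] at this
  omega

/-! ### Marked sets and the invariants of reduction -/

variable {d : Fin m → ℤ} {A : Type u} [CommRing A] {f : P → FreeMod m n A}

theorem IsMarkedSet.coeffAt_self (hP : IsPommaretBasis U P) (hf : IsMarkedSet d U P f) (τ : P) :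
    coeffAt τ.1 (f τ) = 1 := by
  by_contra h
  refine hP.not_mem_normalTerms τ.2 ((hf τ).2 τ.1 ?_)
  rw [coeffAt_sub, coeffAt_termVec, if_pos rfl]
  exact sub_ne_zero.2 h

theorem IsMarkedSet.mem_normalTerms (hf : IsMarkedSet d U P f) {τ : P} {σ : Term m n}
    (hσ : coeffAt σ (f τ) ≠ 0) (hne : σ ≠ τ.1) : σ ∈ normalTerms U := by
  refine (hf τ).2 σ ?_
  rwa [coeffAt_sub, coeffAt_termVec, if_neg hne, sub_zero]

/-- The head of `x^δ f_τ` lies in only one cone; every other term is `x^δ` times a normal term,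
whose multiplier in any cone is smaller. This triangularity drives both termination and
independence. -/
theorem IsMarkedSet.coeffAt_shift_ne_zero (hP : IsPommaretBasis U P) (hf : IsMarkedSet d U P f)
    {τ τ' : P} {δ δ' : Fin (n + 1) →₀ ℕ} (hδ : IsMultTerm δ τ.1) (hδ' : IsMultTerm δ' τ'.1)
    (h : coeffAt (shift δ' τ'.1) (MvPolynomial.monomial δ (1 : A) • f τ) ≠ 0) :
    (τ' = τ ∧ δ' = δ) ∨ toColex δ' < toColex δ := by
  obtain ⟨σ, hσ, h'⟩ := coeffAt_monomial_smul _ _ _ h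
  rcases eq_or_ne σ τ.1 with rfl | hne
  · exact Or.inl (hP.eq_of_shift_eq hδ' hδ hσ)
  · exact Or.inr (hP.toColex_lt_of_mem_normalTerms (hf.mem_normalTerms h' hne) τ'.2 hδ' hσ.symm)

theorem IsMarkedSet.coeffAt_shift_self (hP : IsPommaretBasis U P) (hf : IsMarkedSet d U P f)
    (τ : P) (δ : Fin (n + 1) →₀ ℕ) :
    coeffAt (shift δ τ.1) (MvPolynomial.monomial δ (1 : A) • f τ) = 1 := by
  rw [coeffAt_shift_monomial_smul, hf.coeffAt_self hP]

theorem IsMarkedSet.monomial_smul_mem_gradedPiece (hf : IsMarkedSet d U P f) (τ : P)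
    (δ : Fin (n + 1) →₀ ℕ) (c : A) :
    MvPolynomial.monomial δ c • f τ ∈ gradedPiece (A := A) d (termDeg d (shift δ τ.1)) := by
  rw [monomial_smul_eq]
  refine Submodule.smul_mem _ _ fun ρ hρ => ?_
  obtain ⟨ρ', rfl, h'⟩ := coeffAt_monomial_smul δ (f τ) ρ hρ
  rw [termDeg_shift, termDeg_shift, (hf τ).1 ρ' h']

theorem ReductionStep.sub_mem_span {h h' : FreeMod m n A} (hs : ReductionStep P f h h') :
    h - h' ∈ Submodule.span (MvPolynomial (Fin (n + 1)) A) (Set.range f) := by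
  obtain ⟨τ, δ, -, -, rfl⟩ := hs
  rw [sub_sub_cancel]
  exact Submodule.smul_mem _ _ (Submodule.subset_span ⟨τ, rfl⟩)

theorem IsCompleteReduction.sub_mem_span {h g : FreeMod m n A}
    (hr : IsCompleteReduction U P f h g) :
    h - g ∈ Submodule.span (MvPolynomial (Fin (n + 1)) A) (Set.range f) := by
  obtain ⟨hr, -⟩ := hr
  induction hr with
  | refl => rw [sub_self]; exact zero_mem _
  | tail _ hs ih =>
    rw [← sub_add_sub_cancel]
    exact add_mem ih hs.sub_mem_span

theorem IsMarkedSet.mem_gradedPiece_of_isCompleteReduction (hf : IsMarkedSet d U P f) {s : ℤ}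
    {h g : FreeMod m n A} (hh : h ∈ gradedPiece (A := A) d s)
    (hr : IsCompleteReduction U P f h g) : g ∈ gradedPiece (A := A) d s := by
  obtain ⟨hr, -⟩ := hr
  induction hr with
  | refl => exact hh
  | tail _ hs ih =>
    obtain ⟨τ, δ, -, hne, rfl⟩ := hs
    refine sub_mem ih ?_
    -- The removed term occurs in a homogeneous element of degree `s`, so the subtracted multiple
    -- has degree `s` too.
    rw [← ih _ hne]
    exact hf.monomial_smul_mem_gradedPiece τ δ _

theorem mem_normalPiece {s : ℤ} {g : FreeMod m n A} (hg : g ∈ gradedPiece (A := A) d s)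
    (hN : SupportedOnNormal U g) : g ∈ normalPiece d U A s := by
  rw [← (termBasis m n A).linearCombination_repr g, Finsupp.linearCombination_apply]
  refine Submodule.sum_mem _ fun i hi => Submodule.smul_mem _ _ (Submodule.subset_span ?_)
  rw [Finsupp.mem_support_iff, termBasis_repr] at hi
  exact ⟨_, ⟨hN _ hi, hg _ hi⟩, (termBasis_apply i).symm⟩

theorem supportedOnNormal_of_mem_normalPiece {s : ℤ} {g : FreeMod m n A}
    (hg : g ∈ normalPiece d U A s) : SupportedOnNormal U g := by
  refine Submodule.span_induction (p := fun x _ => SupportedOnNormal U x) ?_ ?_ ?_ ?_ hg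
  · rintro _ ⟨τ, hτ, rfl⟩ η hη
    rw [coeffAt_termVec] at hη
    by_cases h : η = τ
    · exact h ▸ hτ.1
    · simp [h] at hη
  · intro η hη
    exact absurd (coeffAt_zero η) hη
  · intro x y _ _ hx hy η hη
    by_contra hN
    rw [coeffAt_add, not_not.1 (mt (hx η) hN), not_not.1 (mt (hy η) hN), add_zero] at hη
    exact hη rfl
  · intro a x _ hx η hη
    rw [coeffAt_smul] at hη
    exact hx η (right_ne_zero_of_mul hη)

/-! ### Termination of reduction -/

/-- The `A`-span of the products `x^δ f_τ` with `x^δ` multiplicative for `τ` and smaller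
than `ε`. -/
def multSpan (P : Finset (Term m n)) (f : P → FreeMod m n A) (ε : Colex (Fin (n + 1) →₀ ℕ)) :
    Submodule A (FreeMod m n A) :=
  Submodule.span A {v | ∃ (τ : P) (δ : Fin (n + 1) →₀ ℕ), IsMultTerm δ τ.1 ∧ toColex δ < ε ∧
    v = MvPolynomial.monomial δ (1 : A) • f τ}

theorem multSpan_mono {ε ε' : Colex (Fin (n + 1) →₀ ℕ)} (h : ε ≤ ε') :
    multSpan P f ε ≤ multSpan P f ε' :=
  Submodule.span_mono fun _ ⟨τ, δ, h1, h2, h3⟩ => ⟨τ, δ, h1, h2.trans_le h, h3⟩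

/-- For each of the finitely many `τ`, the multiplier is determined by an exponent in the finite
support of a component of `h`. -/
theorem finite_heads (P : Finset (Term m n)) (h : FreeMod m n A) :
    {δ : Fin (n + 1) →₀ ℕ | ∃ τ : P, IsMultTerm δ τ.1 ∧ coeffAt (shift δ τ.1) h ≠ 0}.Finite := by
  have hfin : (⋃ τ : P, (fun δ => δ + τ.1.2) ⁻¹' ((h τ.1.1).support : Set _)).Finite :=
    Set.finite_iUnion fun τ => Set.Finite.preimage (add_left_injective _).injOn
      (Finset.finite_toSet _)
  refine hfin.subset ?_
  rintro δ ⟨τ, -, hτ⟩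
  refine Set.mem_iUnion.2 ⟨τ, ?_⟩
  simpa [coeffAt, shift] using hτ

/-- Reduce terms with the largest multiplier first: a step removes one of them and creates only
terms with smaller multipliers. The bound on `h - g` records which products were subtracted. -/
theorem IsMarkedSet.exists_isCompleteReduction_of_lt (hP : IsPommaretBasis U P)
    (hf : IsMarkedSet d U P f) (ε : Colex (Fin (n + 1) →₀ ℕ)) (h : FreeMod m n A)
    (hε : ∀ (τ : P) (δ : Fin (n + 1) →₀ ℕ), IsMultTerm δ τ.1 → coeffAt (shift δ τ.1) h ≠ 0 →
      toColex δ < ε) :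
    ∃ g, IsCompleteReduction U P f h g ∧ h - g ∈ multSpan P f ε := by
  classical
  induction ε using WellFoundedLT.induction generalizing h with
  | ind ε ih =>
  by_cases hN : SupportedOnNormal U h
  · exact ⟨h, ⟨Relation.ReflTransGen.refl, hN⟩, by rw [sub_self]; exact zero_mem _⟩
  obtain ⟨δ₀, hδ₀ε, hmax⟩ : ∃ δ₀ : Fin (n + 1) →₀ ℕ, toColex δ₀ < ε ∧
      ∀ (τ : P) (δ : Fin (n + 1) →₀ ℕ), IsMultTerm δ τ.1 → coeffAt (shift δ τ.1) h ≠ 0 →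
        toColex δ ≤ toColex δ₀ := by
    simp only [SupportedOnNormal, not_forall] at hN
    obtain ⟨σ, hσ, hσN⟩ := hN
    obtain ⟨τ, δ, hδ, rfl⟩ := hP.not_mem_normalTerms_iff.1 hσN
    obtain ⟨δ₀, ⟨τ₀, h1, h2⟩, hm⟩ :=
      Set.exists_max_image _ (fun δ => toColex δ) (finite_heads P h) ⟨δ, τ, hδ, hσ⟩
    exact ⟨δ₀, hε τ₀ δ₀ h1 h2, fun τ δ h1 h2 => hm δ ⟨τ, h1, h2⟩⟩
  -- Inner induction on the number of heads with the maximal multiplier `δ₀`; only the bound `hmax`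
  -- has to survive a step.
  clear hε hN
  generalize hk : (Finset.univ.filter fun τ : P =>
    IsMultTerm δ₀ τ.1 ∧ coeffAt (shift δ₀ τ.1) h ≠ 0).card = k
  induction k using Nat.strong_induction_on generalizing h with
  | _ k ihk =>
  by_cases hex : ∃ τ : P, IsMultTerm δ₀ τ.1 ∧ coeffAt (shift δ₀ τ.1) h ≠ 0
  · obtain ⟨τ₀, hτ₀, hne⟩ := hex
    have hstep : ReductionStep P f h
      (h - MvPolynomial.monomial δ₀ (coeffAt (shift δ₀ τ₀.1) h) • f τ₀) :=
      ⟨τ₀, δ₀, hτ₀, hne, rfl⟩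
    set c := coeffAt (shift δ₀ τ₀.1) h with hc
    have hcoeff : ∀ τ δ, coeffAt (shift δ τ) (h - MvPolynomial.monomial δ₀ c • f τ₀) =
        coeffAt (shift δ τ) h -
          c * coeffAt (shift δ τ) (MvPolynomial.monomial δ₀ (1 : A) • f τ₀) := by
      intro τ δ
      rw [coeffAt_sub, monomial_smul_eq, coeffAt_smul]
    have hmem : MvPolynomial.monomial δ₀ c • f τ₀ ∈ multSpan P f ε := by
      rw [monomial_smul_eq]
      exact Submodule.smul_mem _ _ (Submodule.subset_span ⟨τ₀, δ₀, hτ₀, hδ₀ε, rfl⟩)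
    obtain ⟨g, ⟨hg1, hg2⟩, hg3⟩ := ihk _ (by
        rw [← hk]
        refine Finset.card_lt_card (Finset.ssubset_iff_of_subset ?_ |>.2 ⟨τ₀, ?_, ?_⟩)
        · intro τ
          simp only [Finset.mem_filter, Finset.mem_univ, true_and]
          rintro ⟨h1, h2⟩
          refine ⟨h1, fun h0 => ?_⟩
          -- A term newly created by the step could have multiplier `δ₀` only if it were the head
          -- just removed.
          rw [hcoeff, h0, zero_sub, neg_ne_zero] at h2
          rcases hf.coeffAt_shift_ne_zero hP hτ₀ h1 (right_ne_zero_of_mul h2) with ⟨rfl, -⟩ | hlt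
          · exact hne h0
          · exact lt_irrefl _ hlt
        · simp only [Finset.mem_filter, Finset.mem_univ, true_and]
          exact ⟨hτ₀, hne⟩
        · simp only [Finset.mem_filter, Finset.mem_univ, true_and, not_and, not_not]
          intro _
          rw [hcoeff, hf.coeffAt_shift_self hP, mul_one, hc, sub_self])
      (h - MvPolynomial.monomial δ₀ c • f τ₀) (by
        intro τ δ h1 h2
        rw [hcoeff] at h2
        by_cases h0 : coeffAt (shift δ τ.1) h = 0
        · rw [h0, zero_sub, neg_ne_zero] at h2
          rcases hf.coeffAt_shift_ne_zero hP hτ₀ h1 (right_ne_zero_of_mul h2) with ⟨-, rfl⟩ | hlt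
          · exact le_rfl
          · exact hlt.le
        · exact hmax τ δ h1 h0) rfl
    refine ⟨g, ⟨Relation.ReflTransGen.head hstep hg1, hg2⟩, ?_⟩
    have := add_mem hg3 hmem
    rwa [sub_right_comm, sub_add_cancel] at this
  -- No multiplier equals `δ₀` any more, so `δ₀` is a strict bound for the outer induction.
  · obtain ⟨g, hg1, hg2⟩ := ih (toColex δ₀) hδ₀ε h fun τ δ h1 h2 =>
      lt_of_le_of_ne (hmax τ δ h1 h2) fun heq => hex ⟨τ, toColex_inj.1 heq ▸ ⟨h1, h2⟩⟩
    exact ⟨g, hg1, multSpan_mono hδ₀ε.le hg2⟩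

theorem IsMarkedSet.exists_isCompleteReduction (hP : IsPommaretBasis U P)
    (hf : IsMarkedSet d U P f) (h : FreeMod m n A) : ∃ g, IsCompleteReduction U P f h g := by
  obtain ⟨b, hb⟩ := ((finite_heads P h).image toColex).bddAbove
  -- Multiplying by `x_0` turns the bound `b` into a strict one.
  have hlt : b < b + toColex (Finsupp.single 0 1) := by
    refine lt_add_of_pos_right b (Finsupp.Colex.lt_iff.2 ⟨0, fun j hj => ?_, ?_⟩)
    · change 0 = (Finsupp.single 0 1 : Fin (n + 1) →₀ ℕ) j
      rw [Finsupp.single_eq_of_ne hj.ne']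
    · change 0 < (Finsupp.single 0 1 : Fin (n + 1) →₀ ℕ) 0
      simp
  obtain ⟨g, hg, -⟩ := hf.exists_isCompleteReduction_of_lt hP _ h fun τ δ h1 h2 =>
    (hb ⟨δ, ⟨τ, h1, h2⟩, rfl⟩).trans_lt hlt
  exact ⟨g, hg⟩

/-- For a non-multiplicative variable `x_i` of `τ`, the complete reduction of `x_i f_τ` uses only
products `x^δ f_σ` with `x^δ` smaller than `x_i`. -/
theorem IsMarkedSet.exists_isCompleteReduction_X_smul (hP : IsPommaretBasis U P)
    (hf : IsMarkedSet d U P f) {τ : P} {i : Fin (n + 1)} (hi : ¬ IsMult i τ.1) :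
    ∃ g, IsCompleteReduction U P f ((MvPolynomial.X i : MvPolynomial (Fin (n + 1)) A) • f τ) g ∧
      (MvPolynomial.X i : MvPolynomial (Fin (n + 1)) A) • f τ - g ∈
        multSpan P f (toColex (Finsupp.single i 1)) := by
  refine hf.exists_isCompleteReduction_of_lt hP _ _ fun τ' δ h1 h2 => ?_
  obtain ⟨σ, hσ, h'⟩ := coeffAt_monomial_smul _ _ _ h2
  rcases eq_or_ne σ τ.1 with rfl | hne
  · exact hP.toColex_lt_single hi h1 hσ.symm
  · exact hP.toColex_lt_of_mem_normalTerms (hf.mem_normalTerms h' hne) τ'.2 h1 hσ.symm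

/-! ### A criterion for marked bases -/

/-- The `A`-span of all products `x^δ f_τ` with `x^δ` multiplicative for `τ`. -/
def fullMultSpan (P : Finset (Term m n)) (f : P → FreeMod m n A) : Submodule A (FreeMod m n A) :=
  Submodule.span A (Set.range fun p : {p : P × (Fin (n + 1) →₀ ℕ) // IsMultTerm p.2 p.1.1} =>
    MvPolynomial.monomial p.1.2 (1 : A) • f p.1.1)

/-- In a nonzero combination choose a product with maximal multiplier. Its head cannot be cancelled
by any other product, so it survives as a term of `U`. -/
theorem IsMarkedSet.eq_zero_of_mem_fullMultSpan (hP : IsPommaretBasis U P)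
    (hf : IsMarkedSet d U P f) {g : FreeMod m n A} (hg : g ∈ fullMultSpan P f)
    (hN : SupportedOnNormal U g) : g = 0 := by
  obtain ⟨c, rfl⟩ := (Finsupp.mem_span_range_iff_exists_finsupp).1 hg
  by_cases hc : c = 0
  · rw [hc, Finsupp.sum_zero_index]
  exfalso
  obtain ⟨⟨⟨τ, δ⟩, hδ⟩, hp, hmax⟩ := Finset.exists_max_image c.support
    (fun p => toColex p.1.2) (Finsupp.support_nonempty_iff.2 hc)
  refine hP.shift_not_mem_normalTerms τ.2 hδ (hN _ ?_)
  rw [Finsupp.sum, coeffAt_sum, Finset.sum_eq_single_of_mem _ hp]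
  · rw [coeffAt_smul, hf.coeffAt_shift_self hP, mul_one]
    exact Finsupp.mem_support_iff.1 hp
  · rintro ⟨⟨τ', δ'⟩, hδ'⟩ hp' hne
    rw [coeffAt_smul]
    by_contra h0
    rcases hf.coeffAt_shift_ne_zero hP hδ' hδ (right_ne_zero_of_mul h0) with ⟨rfl, rfl⟩ | hlt
    · exact hne rfl
    · exact (hmax _ hp').not_gt hlt

/-- Well-founded induction on the multiplier `γ`: if `x_i` divides `x^γ` and is not multiplicative
for `τ`, rewriting `x_i f_τ` by `hX` replaces `γ = γ' + e_i` by smaller multipliers `γ' + δ`,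
possibly on other elements of the set. -/
theorem span_le_fullMultSpan
    (hX : ∀ (τ : P) (i : Fin (n + 1)), ¬ IsMult i τ.1 →
      (MvPolynomial.X i : MvPolynomial (Fin (n + 1)) A) • f τ ∈
        multSpan P f (toColex (Finsupp.single i 1))) :
    (Submodule.span (MvPolynomial (Fin (n + 1)) A) (Set.range f)).restrictScalars A ≤
      fullMultSpan P f := by
  have hmon : ∀ (γ : Colex (Fin (n + 1) →₀ ℕ)) (τ : P),
      MvPolynomial.monomial (ofColex γ) (1 : A) • f τ ∈ fullMultSpan P f := by
    intro γ
    induction γ using WellFoundedLT.induction with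
    | ind γ ih =>
    intro τ
    by_cases hγ : IsMultTerm (ofColex γ) τ.1
    · exact Submodule.subset_span ⟨⟨(τ, ofColex γ), hγ⟩, rfl⟩
    simp only [IsMultTerm, not_forall] at hγ
    obtain ⟨i, hi, hmult⟩ := hγ
    have hle : Finsupp.single i 1 ≤ ofColex γ := by
      rw [Finsupp.single_le_iff]
      exact Nat.one_le_iff_ne_zero.2 (Finsupp.mem_support_iff.1 hi)
    set γ' := ofColex γ - Finsupp.single i 1 with hγ'
    have hadd : γ' + Finsupp.single i 1 = ofColex γ := tsub_add_cancel_of_le hle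
    have hsplit : MvPolynomial.monomial (ofColex γ) (1 : A) • f τ =
        MvPolynomial.monomial γ' (1 : A) •
          ((MvPolynomial.X i : MvPolynomial (Fin (n + 1)) A) • f τ) := by
      rw [← hadd, MvPolynomial.X, ← mul_smul, MvPolynomial.monomial_mul, one_mul]
    rw [hsplit]
    refine Submodule.span_induction (p := fun x _ =>
      MvPolynomial.monomial γ' (1 : A) • x ∈ fullMultSpan P f) ?_ ?_ ?_ ?_ (hX τ i hmult)
    · rintro _ ⟨σ, δ, -, hδ, rfl⟩
      rw [← mul_smul, MvPolynomial.monomial_mul, one_mul]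
      refine ih (toColex (γ' + δ)) ?_ σ
      have h1 : γ = toColex γ' + toColex (Finsupp.single i 1) := by
        rw [← toColex_add, hadd, toColex_ofColex]
      rw [h1, toColex_add]
      exact add_lt_add_right hδ _
    · rw [smul_zero]; exact zero_mem _
    · intro x y _ _ hx hy
      rw [smul_add]
      exact add_mem hx hy
    · intro a x _ hx
      rw [smul_comm]
      exact Submodule.smul_mem _ _ hx
  intro h hh
  change h ∈ Submodule.span (MvPolynomial (Fin (n + 1)) A) (Set.range f) at hh
  induction hh using Submodule.closure_induction with
  | zero => exact zero_mem _
  | add x y _ _ hx hy => exact add_mem hx hy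
  | smul_mem p x hx =>
    obtain ⟨τ, rfl⟩ := hx
    induction p using MvPolynomial.induction_on' with
    | monomial δ c =>
      rw [monomial_smul_eq]
      exact Submodule.smul_mem _ _ (hmon (toColex δ) τ)
    | add p q hp hq => rw [add_smul]; exact add_mem hp hq

/-- A marked set is a marked basis as soon as the products `x_i f_τ` with `x_i` non-multiplicative
reduce to zero. -/
theorem IsMarkedSet.isMarkedBasis (hP : IsPommaretBasis U P) (hf : IsMarkedSet d U P f)
    (hX : ∀ (τ : P) (i : Fin (n + 1)), ¬ IsMult i τ.1 →
      (MvPolynomial.X i : MvPolynomial (Fin (n + 1)) A) • f τ ∈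
        multSpan P f (toColex (Finsupp.single i 1))) : IsMarkedBasis d U P f := by
  refine ⟨hf, fun s => le_antisymm (sup_le inf_le_right (normalPiece_le_gradedPiece s)) ?_,
    fun s => ?_⟩
  · intro h hh
    obtain ⟨g, hg⟩ := hf.exists_isCompleteReduction hP h
    have hgs := hf.mem_gradedPiece_of_isCompleteReduction hh hg
    rw [← sub_add_cancel h g]
    exact Submodule.add_mem_sup ⟨hg.sub_mem_span, sub_mem hh hgs⟩ (mem_normalPiece hgs hg.2)
  · rw [Submodule.disjoint_def]
    intro g hg hN
    exact hf.eq_zero_of_mem_fullMultSpan hP (span_le_fullMultSpan hX hg.1)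
      (supportedOnNormal_of_mem_normalPiece hN)

end Pommaret

/-! ### The generic marked set and its specialisations -/

section Generic

variable {m n : ℕ} {K : Type u} [Field K] {d : Fin m → ℤ}
  {U : Submodule (MvPolynomial (Fin (n + 1)) K) (FreeMod m n K)} {P : Finset (Term m n)}

theorem coeffAt_genericSet (τ : P) (σ : Term m n) :
    coeffAt σ (genericSet d U P τ) = coeffAt σ (termVec (ParamRing d U P) τ.1) -
      ∑ η : Tail d U P τ, (MvPolynomial.X ⟨τ, η⟩ : ParamRing d U P) *
        coeffAt σ (termVec (ParamRing d U P) η.1) := by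
  rw [genericSet, coeffAt_sub, coeffAt_sum]
  simp only [coeffAt_smul]

theorem coeffAt_genericSet_of_tail (hP : IsPommaretBasis U P) (τ : P) (η : Tail d U P τ) :
    coeffAt η.1 (genericSet d U P τ) = -MvPolynomial.X ⟨τ, η⟩ := by
  have hne : η.1 ≠ τ.1 := fun h => hP.not_mem_normalTerms τ.2 (h ▸ η.2.1)
  rw [coeffAt_genericSet, coeffAt_termVec, if_neg hne, zero_sub,
    Finset.sum_eq_single_of_mem η (Finset.mem_univ _), coeffAt_termVec, if_pos rfl, mul_one]
  intro η' _ h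
  rw [coeffAt_termVec, if_neg fun h' => h (Subtype.ext h'.symm), mul_zero]

theorem coeffAt_genericSet_of_not_tail (τ : P) (σ : Term m n)
    (h : ¬ (σ ∈ normalTerms U ∧ termDeg d σ = termDeg d τ.1)) :
    coeffAt σ (genericSet d U P τ) = coeffAt σ (termVec (ParamRing d U P) τ.1) := by
  rw [coeffAt_genericSet, Finset.sum_eq_zero, sub_zero]
  intro η _
  rw [coeffAt_termVec, if_neg (by rintro rfl; exact h η.2), mul_zero]

theorem isMarkedSet_genericSet : IsMarkedSet d U P (genericSet d U P) := by
  refine fun τ => ⟨fun σ hσ => ?_, fun σ hσ => ?_⟩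
  · by_contra h
    rw [coeffAt_genericSet_of_not_tail τ σ fun h' => h h'.2, coeffAt_termVec] at hσ
    exact hσ (if_neg (by rintro rfl; exact h rfl))
  · by_contra h
    rw [coeffAt_sub, coeffAt_genericSet_of_not_tail τ σ fun h' => h h'.1, sub_self] at hσ
    exact hσ rfl

variable {A : Type u} [CommRing A]

/-- A complete reduction `L` of `x_i F_τ` lies in the generated submodule and is supported on
`𝒩(U)`. Both properties survive `φ`, so directness of the sum over `A` kills the image of `L`. -/
theorem map_relations_eq_zero (φ : ParamRing d U P →+* A)
    (hf : IsMarkedBasis d U P fun τ => mapCoeff φ (genericSet d U P τ))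
    {c : ParamRing d U P} (hc : c ∈ relations d U P) : φ c = 0 := by
  obtain ⟨τ, i, -, L, hL, η, -, rfl⟩ := hc
  have hX : (MvPolynomial.X i : MvPolynomial (Fin (n + 1)) (ParamRing d U P)) •
      genericSet d U P τ ∈ gradedPiece (A := ParamRing d U P) d
        (termDeg d (shift (Finsupp.single i 1) τ.1)) :=
    isMarkedSet_genericSet.monomial_smul_mem_gradedPiece τ (Finsupp.single i 1) 1
  have hLs := isMarkedSet_genericSet.mem_gradedPiece_of_isCompleteReduction hX hL
  have h1 := mapCoeff_mem_genPiece φ (d := d) (f := genericSet d U P)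
    (Submodule.mem_inf.2 ⟨hL.sub_mem_span, sub_mem hX hLs⟩)
  have h2 := mapCoeff_mem_normalPiece φ (mem_normalPiece hLs hL.2)
  have h3 : mapCoeff φ L ∈ genPiece d P (fun τ => mapCoeff φ (genericSet d U P τ))
      (termDeg d (shift (Finsupp.single i 1) τ.1)) := by
    have h5 : (MvPolynomial.X i : MvPolynomial (Fin (n + 1)) (ParamRing d U P)) •
        genericSet d U P τ ∈ Submodule.span (MvPolynomial (Fin (n + 1)) (ParamRing d U P))
          (Set.range (genericSet d U P)) :=
      Submodule.smul_mem _ _ (Submodule.subset_span (Set.mem_range_self τ))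
    have h4 : mapCoeff φ ((MvPolynomial.X i : MvPolynomial (Fin (n + 1)) (ParamRing d U P)) •
        genericSet d U P τ) ∈ genPiece d P (fun τ => mapCoeff φ (genericSet d U P τ))
        (termDeg d (shift (Finsupp.single i 1) τ.1)) :=
      mapCoeff_mem_genPiece φ (f := genericSet d U P)
        (Submodule.mem_inf.2 ⟨h5, hX⟩)
    have := sub_mem h4 h1
    rwa [← map_sub, sub_sub_cancel] at this
  rw [← coeffAt_mapCoeff, Submodule.disjoint_def.1 (hf.disjoint _) _ h3 h2, coeffAt_zero]

theorem mapCoeff_mem_multSpan (φ : ParamRing d U P →+* A) {ε : Colex (Fin (n + 1) →₀ ℕ)}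
    {f : P → FreeMod m n (ParamRing d U P)} {h : FreeMod m n (ParamRing d U P)}
    (hh : h ∈ multSpan P f ε) : mapCoeff φ h ∈ multSpan P (fun τ => mapCoeff φ (f τ)) ε := by
  refine Submodule.span_induction
    (p := fun x _ => mapCoeff φ x ∈ multSpan P (fun τ => mapCoeff φ (f τ)) ε) ?_ ?_ ?_ ?_ hh
  · rintro _ ⟨τ, δ, h1, h2, rfl⟩
    refine Submodule.subset_span ⟨τ, δ, h1, h2, ?_⟩
    rw [mapCoeff_poly_smul, MvPolynomial.map_monomial, map_one φ]
  · rw [map_zero]; exact zero_mem _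
  · intro x y _ _ hx hy; rw [map_add]; exact add_mem hx hy
  · intro a x _ hx; rw [map_smulₛₗ]; exact Submodule.smul_mem _ _ hx

/-- One complete reduction with controlled multipliers suffices: its remainder dies under `φ`, which
leaves the specialised `x_i F_τ` in the span of products with multipliers below `x_i`. -/
theorem isMarkedBasis_mapCoeff (hP : IsPommaretBasis U P) (φ : ParamRing d U P →+* A)
    (hφ : ∀ c ∈ relations d U P, φ c = 0) :
    IsMarkedBasis d U P fun τ => mapCoeff φ (genericSet d U P τ) := by
  refine (isMarkedSet_genericSet.map φ).isMarkedBasis hP fun τ i hi => ?_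
  obtain ⟨g, hg, hmem⟩ := isMarkedSet_genericSet.exists_isCompleteReduction_X_smul hP hi
  have hg0 : mapCoeff φ g = 0 := by
    refine ext_coeffAt fun σ => ?_
    rw [coeffAt_mapCoeff, coeffAt_zero]
    -- Nonzero coefficients of `g` sit at normal terms only, hence belong to `ℛ`.
    by_cases hσ : coeffAt σ g = 0
    · rw [hσ, map_zero]
    · exact hφ _ ⟨τ, i, hi, g, hg, σ, hg.2 σ hσ, rfl⟩
  have := mapCoeff_mem_multSpan φ hmem
  rwa [map_sub, hg0, sub_zero, mapCoeff_poly_smul, MvPolynomial.map_X] at this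

variable [Algebra K A]

/-- The specialisation of the parameters at the coefficients of a family `f`. -/
def specialise (f : P → FreeMod m n A) : ParamRing d U P →ₐ[K] A :=
  -- The sign undoes the minus in front of the tail of `F_τ`.
  MvPolynomial.aeval fun p => -coeffAt p.2.1 (f p.1)

theorem mapCoeff_specialise (hP : IsPommaretBasis U P) {f : P → FreeMod m n A}
    (hf : IsMarkedSet d U P f) (τ : P) :
    mapCoeff (specialise f : ParamRing d U P →ₐ[K] A).toRingHom (genericSet d U P τ) = f τ := by
  refine ext_coeffAt fun σ => ?_
  rw [coeffAt_mapCoeff]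
  by_cases h : σ ∈ normalTerms U ∧ termDeg d σ = termDeg d τ.1
  · rw [coeffAt_genericSet_of_tail hP τ ⟨σ, h⟩, map_neg]
    simp [specialise]
  · rw [coeffAt_genericSet_of_not_tail τ σ h, ← coeffAt_mapCoeff, mapCoeff_termVec]
    by_contra hne
    have h0 : coeffAt σ (f τ - termVec A τ.1) ≠ 0 := by
      rw [coeffAt_sub]
      exact sub_ne_zero.2 (Ne.symm hne)
    have hN := (hf τ).2 σ h0
    have hστ : σ ≠ τ.1 := fun h' => hP.not_mem_normalTerms τ.2 (h' ▸ hN)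
    rw [coeffAt_sub, coeffAt_termVec, if_neg hστ, sub_zero] at h0
    exact h ⟨hN, (hf τ).1 σ h0⟩

theorem specialise_mapCoeff (hP : IsPommaretBasis U P) (φ : ParamRing d U P →ₐ[K] A) :
    specialise (fun τ => mapCoeff φ.toRingHom (genericSet d U P τ)) = φ := by
  refine MvPolynomial.algHom_ext fun ⟨τ, η⟩ => ?_
  simp only [specialise, MvPolynomial.aeval_X]
  rw [coeffAt_mapCoeff, coeffAt_genericSet_of_tail hP, map_neg, neg_neg]
  rfl

/-- The marked bases in `A[x]^m_d` are the specialisations of the generic marked set along the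
`K`-algebra homomorphisms from `K[C]/⟨ℛ⟩`. -/
def algHomEquivMarkedBasis (hP : IsPommaretBasis U P) :
    (CoordRing d U P →ₐ[K] A) ≃ {f : P → FreeMod m n A // IsMarkedBasis d U P f} where
  toFun ψ := ⟨fun τ => mapCoeff
      (ψ.toRingHom.comp (Ideal.Quotient.mk (Ideal.span (relations d U P)))) (genericSet d U P τ),
    isMarkedBasis_mapCoeff hP _ fun c hc => by
      rw [RingHom.comp_apply, Ideal.Quotient.eq_zero_iff_mem.2 (Ideal.subset_span hc), map_zero]⟩
  invFun f := Ideal.Quotient.liftₐ _ (specialise f.1) fun c hc => by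
    have hle : Ideal.span (relations d U P) ≤
        RingHom.ker (specialise f.1 : ParamRing d U P →ₐ[K] A).toRingHom :=
      Ideal.span_le.2 fun c hc => map_relations_eq_zero _
        (by simpa only [mapCoeff_specialise hP f.2.marked] using f.2) hc
    exact hle hc
  left_inv ψ := by
    refine Ideal.Quotient.algHom_ext K ?_
    refine Eq.trans ?_
      (specialise_mapCoeff hP (ψ.comp (Ideal.Quotient.mkₐ K (Ideal.span (relations d U P)))))
    ext1 p
    rfl
  right_inv f := Subtype.ext (funext fun τ => mapCoeff_specialise hP f.2.marked τ)

end Generic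

/-! ### Passage to schemes and naturality -/

section Representability

variable {m n : ℕ} {K : Type u} [Field K] {d : Fin m → ℤ}
  {U : Submodule (MvPolynomial (Fin (n + 1)) K) (FreeMod m n K)} {P : Finset (Term m n)}

variable (d U P) in
/-- `K`-algebra homomorphisms `K[C]/⟨ℛ⟩ → A` are the `A`-points of the marked scheme. -/
def algHomEquivPoints (A : NoethAlgCat K) :
    (CoordRing d U P →ₐ[K] A.obj) ≃ (pointsFunctor (markedScheme d U P)).obj A where
  toFun ψ := markedPoint d U P A ψ
  invFun p := (algSpec.fullyFaithful.preimage
    (X := op A.obj) (Y := op (CommAlgCat.of (CommRingCat.of K) (CoordRing d U P))) p).unop.hom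
  left_inv ψ := by
    simp only [markedPoint]
    erw [algSpec.fullyFaithful.preimage_map]
    rfl
  right_inv p := algSpec.fullyFaithful.map_preimage
    (X := op A.obj) (Y := op (CommAlgCat.of (CommRingCat.of K) (CoordRing d U P))) p

theorem pointsFunctor_map_markedPoint {A B : NoethAlgCat K} (σ : A ⟶ B)
    (ψ : CoordRing d U P →ₐ[K] A.obj) :
    (pointsFunctor (markedScheme d U P)).map σ (markedPoint d U P A ψ) =
      markedPoint d U P B (σ.hom.hom.comp ψ) :=
  ((algSpec (CommRingCat.of K)).map_comp σ.hom.op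
    (CommAlgCat.ofHom (R := CommRingCat.of K) (Y := A.obj) ψ).op).symm

/-- The functor of points of the marked scheme is the functor of marked bases. -/
def pointsIsoMarkedBasis (hP : IsPommaretBasis U P) :
    pointsFunctor (markedScheme d U P) ≅ markedBasisFunctor d U P :=
  NatIso.ofComponents (F := pointsFunctor (markedScheme d U P)) (G := markedBasisFunctor d U P)
    (fun A => Equiv.toIso (Y := (markedBasisFunctor d U P).obj A)
      ((algHomEquivPoints d U P A).symm.trans (algHomEquivMarkedBasis hP)))
    (by
      intro A B σ
      refine ConcreteCategory.hom_ext _ _ fun p => ?_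
      -- Every point comes from some `ψ`, so naturality reduces to the fact that mapping
      -- coefficients respects composition of ring maps.
      obtain ⟨ψ, rfl⟩ := (algHomEquivPoints d U P A).surjective p
      have h1 : (algHomEquivPoints d U P B).symm
          ((pointsFunctor (markedScheme d U P)).map σ (markedPoint d U P A ψ)) =
          σ.hom.hom.comp ψ := by
        rw [pointsFunctor_map_markedPoint]
        exact (algHomEquivPoints d U P B).symm_apply_apply _
      have h2 := (algHomEquivPoints d U P A).symm_apply_apply ψ
      refine ((congrArg (algHomEquivMarkedBasis hP) h1).trans ?_).trans
        (congrArg (fun ψ => (markedBasisFunctor d U P).map σ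
          (algHomEquivMarkedBasis hP ψ)) h2).symm
      refine Subtype.ext (funext fun τ => funext fun k => ?_)
      exact (MvPolynomial.map_map
        (ψ.toRingHom.comp (Ideal.Quotient.mk (Ideal.span (relations d U P))))
        σ.hom.hom.toRingHom _).symm)

end Representability

end MarkedBases

end

open MarkedBases

theorem mainTheorem6 {K : Type u} [Field K] (n m : ℕ) (d : Fin m → ℤ)
    (U : Submodule (MvPolynomial (Fin (n + 1)) K) (FreeMod m n K)) (P : Finset (Term m n))
    (hP : IsPommaretBasis U P) :
    ∃ e : markedBasisFunctor d U P ≅ pointsFunctor (markedScheme d U P),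
      ∀ (A : NoethAlgCat K) (ψ : CoordRing d U P →ₐ[K] A.obj) (τ : P),
        (e.inv.app A (markedPoint d U P A ψ)).1 τ =
          mapCoeff (ψ.toRingHom.comp (Ideal.Quotient.mk (Ideal.span (relations d U P))))
            (genericSet d U P τ) := by
  refine ⟨(pointsIsoMarkedBasis hP).symm, fun A ψ τ => ?_⟩
  have h : (pointsIsoMarkedBasis hP).hom.app A (markedPoint d U P A ψ) =
      algHomEquivMarkedBasis hP ψ :=
    congrArg (algHomEquivMarkedBasis hP) ((algHomEquivPoints d U P A).symm_apply_apply ψ)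
  exact congrFun (congrArg Subtype.val h) τ
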